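/- A hypergraph $\mathcal H=(V,E)$ consists of a nonempty finite vertex set $V$ and a finite collection $E$ of subsets of $V$ (its edges); it is called nonempty if $E\neq\varnothing$. The general Kneser graph $\operatorname{KG}(\mathcal H)$ is the graph whose vertices are the edges of $\mathcal H$, two distinct ones being adjacent if and only if they are disjoint. A hypergraph is $2$-colorable if its vertices can be colored with $2$ colors so that no edge is monochromatic (the empty edge counts as monochromatic). The $2$-colorability defect of $\mathcal H$ is $$\operatorname{cd}_2(\mathcal H)=\min\bigl\{|U| : U\subseteq V,\ \bigl(V\setminus U,\{e\in E : e\cap U=\varnothing\}\bigr)\text{ is $2$-colorable}\bigr\}$$ (with $\operatorname{cd}_2(\mathcal H)=\infty$ if there is no such $U$). For integers $p\ge q\ge 1$, a $(p,q)$-coloring of a graph $G$ is a map $c:V(G)\to\{1,\dots,p\}$ such that $q\le|c(u)-c(v)|\le p-q$ for every edge $uv$ of $G$, and the circular chromatic number of $G$ is $\chi_c(G)=\inf\{p/q : G\text{ admits a }(p,q)\text{-coloring}\}$. As usual, $\chi(G)$ denotes the chromatic number of $G$. **Corollary.** Let $\mathcal H$ be a nonempty hypergraph (possibly with one-element edges)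 such that $\chi(\operatorname{KG}(\mathcal H))=\operatorname{cd}_2(\mathcal H)$. Then $\chi(\operatorname{KG}(\mathcal H))=\chi_c(\operatorname{KG}(\mathcal H))$. -/

import Mathlib

open scoped ENNReal

namespace Hypergraph

/-- The general Kneser graph `KG(H)`: its vertices are the edges of `H`, and two distinct edges of
`H` are adjacent when they are disjoint. -/
def kneserGraph {α : Type*} (H : Hypergraph α) : SimpleGraph H.edgeSet where
  Adj e f := e ≠ f ∧ Disjoint (e : Set α) (f : Set α)
  symm := ⟨fun _ _ h => ⟨h.1.symm, h.2.symm⟩⟩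
  loopless := ⟨fun _ h => h.1 rfl⟩

/-- `H` is 2-colorable: its vertices can be colored with two colors so that no edge is
monochromatic. (An edge is monochromatic if all its vertices have one color; only the colors of
the vertices of `H` matter, since edges consist of vertices of `H`.) -/
def IsTwoColorable {α : Type*} (H : Hypergraph α) : Prop :=
  ∃ c : α → Bool, ∀ e ∈ H.edgeSet, ¬ ∃ b : Bool, ∀ x ∈ e, c x = b

/-- The partial hypergraph `(V(H) \ U, {e ∈ E(H) : e ∩ U = ∅})` left after removing `U`. -/
def removeVertices {α : Type*} (H : Hypergraph α) (U : Set α) : Hypergraph α where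
  vertexSet := H.vertexSet \ U
  edgeSet := {e | e ∈ H.edgeSet ∧ e ∩ U = ∅}
  subset_vertexSet_of_mem_edgeSet' := fun _ he x hx =>
    ⟨H.subset_vertexSet_of_mem_edgeSet' he.1 hx,
      fun hU => Set.notMem_empty x (he.2 ▸ ⟨hx, hU⟩)⟩

/-- The 2-colorability defect `cd₂(H)`: the minimal number of vertices whose removal leaves a
2-colorable hypergraph (`⊤` if there is no such set of vertices, which for a hypergraph on a
finite vertex set happens only when `∅` is an edge). -/
noncomputable def colorabilityDefect {α : Type*} (H : Hypergraph α) : ℕ∞ :=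
  ⨅ U ∈ {U : Set α | U ⊆ H.vertexSet ∧ (H.removeVertices U).IsTwoColorable}, U.encard

end Hypergraph

namespace SimpleGraph

/-- `c` is a `(p, q)`-coloring of `G`: `q ≤ |c(u) - c(v)| ≤ p - q` for every edge `uv`. The color
set is `{0, …, p - 1}` instead of `{1, …, p}`; only differences of colors matter. -/
def IsCircularColoring {V : Type*} (G : SimpleGraph V) (p q : ℕ) (c : V → Fin p) : Prop :=
  ∀ u v : V, G.Adj u v →
    (q : ℤ) ≤ |((c u : ℕ) : ℤ) - ((c v : ℕ) : ℤ)| ∧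
      |((c u : ℕ) : ℤ) - ((c v : ℕ) : ℤ)| ≤ (p : ℤ) - (q : ℤ)

/-- The circular chromatic number `χ_c(G)`: the infimum of `p / q` over all integers `p ≥ q ≥ 1`
such that `G` admits a `(p, q)`-coloring (`⊤` if there are none). -/
noncomputable def circularChromaticNumber {V : Type*} (G : SimpleGraph V) : ℝ≥0∞ :=
  sInf {r : ℝ≥0∞ | ∃ p q : ℕ, 1 ≤ q ∧ q ≤ p ∧ (∃ c : V → Fin p, G.IsCircularColoring p q c) ∧
    r = (p : ℝ≥0∞) / (q : ℝ≥0∞)}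

end SimpleGraph

/-! The inequality `χ_c ≤ χ` is elementary. For the converse let `t = χ = cd₂` and suppose that `f`
is a `(p, q)`-coloring with `p < t * q`. Then `f / q` is a proper coloring with `t` colors. By
`exists_crown` there are edges `a j`, `b j` of color `j` for every `j < t`, with `a i` disjoint from
`b j` whenever `i ≠ j`. Following `f` around this crown forces `t * q ≤ p`
(`SimpleGraph.IsCircularColoring.mul_le_of_crown`).

The crown comes from a combinatorial Tucker-type lemma. A signed set is a partial 2-coloring of the
vertices. If it misses fewer than `cd₂` vertices, it contains a monochromatic edge, and the sign of
its largest edge color is well defined because edges of opposite signs are disjoint. By a parity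
count (`exists_alternating_flag`) every antipodal sign alternates along some full flag. Alternation
makes the top colors increase, so the set of the critical size `d` in the flag contains no edge and
the `t` sets above it use up all colors. Give each such edge-free set the sign of the first set
above it: this contradicts alternation. Hence that rule must be ambiguous somewhere, and an
edge-free set below two flags of opposite signs yields the crown (`exists_crown_of_isUpperFlag`). -/

/-! ### Counting weighted maximal flags modulo 2 -/

section FlagCount

variable {β : Type*} [DecidableEq β]

/-- The sum over all maximal flags `∅ ⊂ X₁ ⊂ ⋯ ⊂ X` of the products of the weights of their
nonempty members. -/
def flagCount (w : Finset β → ZMod 2) (X : Finset β) : ZMod 2 :=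
  if X = ∅ then 1 else w X * ∑ a ∈ X.attach, flagCount w (X.erase a.1)
termination_by X.card
decreasing_by exact Finset.card_erase_lt_of_mem a.2

theorem flagCount_empty (w : Finset β → ZMod 2) : flagCount w ∅ = 1 := by
  rw [flagCount, if_pos rfl]

theorem flagCount_of_nonempty (w : Finset β → ZMod 2) {X : Finset β} (hX : X.Nonempty) :
    flagCount w X = w X * ∑ a ∈ X, flagCount w (X.erase a) := by
  rw [flagCount, if_neg hX.ne_empty, Finset.sum_attach X fun a => flagCount w (X.erase a)]

/-- This is `∂² = 0` modulo 2: each set with two points fewer arises from both orders of erasure. -/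
theorem sum_erase_erase_eq_zero (f : Finset β → ZMod 2) (X : Finset β) :
    ∑ a ∈ X, ∑ b ∈ X.erase a, f ((X.erase a).erase b) = 0 := by
  rw [Finset.sum_sigma']
  refine Finset.sum_involution (fun p _ => ⟨p.2, p.1⟩) ?_ ?_ ?_ ?_
  · rintro ⟨a, b⟩ _
    simp only [Finset.erase_right_comm (a := b) (b := a)]
    exact CharTwo.add_self_eq_zero _
  · rintro ⟨a, b⟩ h _ h'
    simp only [Finset.mem_sigma, Finset.mem_erase] at h
    exact h.2.1 (congrArg Sigma.fst h')
  · rintro ⟨a, b⟩ h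
    simp only [Finset.mem_sigma, Finset.mem_erase] at h ⊢
    exact ⟨h.2.2, h.2.1.symm, h.1⟩
  · rintro ⟨a, b⟩ _
    rfl

/-- By induction the two terms for a facet differ only in its own weight, `1 + w` against `w`, so
their sum is the unweighted sum over the facets of that facet; the total vanishes by `∂² = 0`. -/
theorem sum_flagCount_erase_one_add (w : Finset β → ZMod 2) {X : Finset β} (hX : X.Nonempty) :
    ∑ a ∈ X, flagCount (fun Y => 1 + w Y) (X.erase a) = ∑ a ∈ X, flagCount w (X.erase a) := by
  induction X using Finset.strongInduction with
  | H X ih =>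
  rw [← sub_eq_zero, ← Finset.sum_sub_distrib]
  by_cases hc : ∃ a, X = {a}
  · obtain ⟨a, rfl⟩ := hc
    simp [flagCount_empty]
  · rw [← sum_erase_erase_eq_zero (flagCount w) X]
    refine Finset.sum_congr rfl fun a ha => ?_
    have hne : (X.erase a).Nonempty := by
      rw [Finset.nonempty_iff_ne_empty]
      intro h
      rw [Finset.erase_eq_empty_iff] at h
      rcases h with h | h
      · exact hX.ne_empty h
      · exact hc ⟨a, h⟩
    rw [flagCount_of_nonempty _ hne, flagCount_of_nonempty _ hne,
      ih _ (Finset.erase_ssubset ha) hne, CharTwo.sub_eq_add, ← add_mul, add_assoc,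
      CharTwo.add_self_eq_zero, add_zero, one_mul]

/-- A nonzero flag count yields a maximal flag all of whose nonempty members have weight one. -/
theorem exists_flag_of_flagCount_ne_zero (w : Finset β → ZMod 2) {X : Finset β}
    (h : flagCount w X ≠ 0) :
    ∃ F : ℕ → Finset β, F X.card = X ∧ (∀ k ≤ X.card, (F k).card = k) ∧
      (∀ k < X.card, F k ⊆ F (k + 1)) ∧ ∀ k, 0 < k → k ≤ X.card → w (F k) = 1 := by
  obtain ⟨n, hn⟩ : ∃ n, X.card = n := ⟨_, rfl⟩
  rw [hn]
  induction n generalizing X with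
  | zero =>
    exact ⟨fun _ => X, rfl, fun k hk => hn.trans (by omega), fun k hk => by omega,
      fun k _ _ => by omega⟩
  | succ n ih =>
    have hne : X.Nonempty := Finset.card_pos.mp (by omega)
    rw [flagCount_of_nonempty _ hne] at h
    obtain ⟨a, ha, ha'⟩ := Finset.exists_ne_zero_of_sum_ne_zero (right_ne_zero_of_mul h)
    have hw : w X = 1 := by
      have : ∀ z : ZMod 2, z ≠ 0 → z = 1 := by decide
      exact this _ (left_ne_zero_of_mul h)
    have hcard : (X.erase a).card = n := by rw [Finset.card_erase_of_mem ha]; omega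
    obtain ⟨F, h1, h2, h3, h4⟩ := ih ha' hcard
    refine ⟨fun k => if k ≤ n then F k else X, by simp, ?_, ?_, ?_⟩
    · intro k hk
      by_cases hkn : k ≤ n
      · simpa [hkn] using h2 k hkn
      · simp only [hkn, if_false]; omega
    · intro k hk
      by_cases hkn : k + 1 ≤ n
      · simpa [hkn, show k ≤ n by omega] using h3 k (by omega)
      · obtain rfl : k = n := by omega
        simpa [h1] using Finset.erase_subset a X
    · intro k hk hk'
      by_cases hkn : k ≤ n
      · simpa [hkn] using h4 k hk hkn
      · simpa [hkn] using hw

end FlagCount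

/-! ### Signed sets and a Tucker-type lemma -/

section SignedSets

variable {ι : Type*}

/-- No point carries both signs. -/
def IsConsistent (X : Finset (ι × Bool)) : Prop :=
  ∀ i, (i, true) ∈ X → (i, false) ∉ X

theorem IsConsistent.mono {X Y : Finset (ι × Bool)} (hY : IsConsistent Y) (h : X ⊆ Y) :
    IsConsistent X :=
  fun i h1 h2 => hY i (h h1) (h h2)

theorem IsConsistent.not_mem {X : Finset (ι × Bool)} (hX : IsConsistent X) {i : ι} {b : Bool}
    (h : (i, b) ∈ X) : (i, !b) ∉ X := by
  cases b
  · exact fun h' => hX i h' h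
  · exact hX i h

variable [DecidableEq ι]

/-- The signed set obtained by reversing all signs. -/
def flipSigns (X : Finset (ι × Bool)) : Finset (ι × Bool) :=
  X.image fun p => (p.1, !p.2)

/-- The signed set with support `S` whose positive points are those in `A`. -/
def signedSection (S A : Finset ι) : Finset (ι × Bool) :=
  S.image fun i => (i, decide (i ∈ A))

theorem mem_flipSigns {X : Finset (ι × Bool)} {i : ι} {b : Bool} :
    (i, b) ∈ flipSigns X ↔ (i, !b) ∈ X := by
  simp only [flipSigns, Finset.mem_image, Prod.mk.injEq, Prod.exists]
  constructor
  · rintro ⟨_, _, h, rfl, rfl⟩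
    simpa using h
  · intro h
    exact ⟨i, !b, h, rfl, by simp⟩

theorem flipSigns_flipSigns (X : Finset (ι × Bool)) : flipSigns (flipSigns X) = X := by
  ext ⟨i, b⟩
  simp [mem_flipSigns]

theorem card_flipSigns (X : Finset (ι × Bool)) : (flipSigns X).card = X.card :=
  Finset.card_image_of_injective _ fun p p' h => by
    simp only [Prod.mk.injEq, Bool.not_inj_iff] at h
    exact Prod.ext h.1 h.2

theorem flipSigns_mono {X Y : Finset (ι × Bool)} (h : X ⊆ Y) : flipSigns X ⊆ flipSigns Y :=
  Finset.image_subset_image h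

theorem flipSigns_erase (X : Finset (ι × Bool)) (i : ι) (b : Bool) :
    flipSigns (X.erase (i, b)) = (flipSigns X).erase (i, !b) := by
  ext ⟨j, b'⟩
  simp only [mem_flipSigns, Finset.mem_erase, ne_eq, Prod.mk.injEq]
  cases b <;> cases b' <;> simp

theorem IsConsistent.flipSigns {X : Finset (ι × Bool)} (hX : IsConsistent X) :
    IsConsistent (flipSigns X) := fun i h1 h2 => by
  rw [mem_flipSigns] at h1 h2
  exact hX i h2 h1

theorem IsConsistent.flipSigns_ne {X : Finset (ι × Bool)} (hX : IsConsistent X)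
    (hne : X.Nonempty) : _root_.flipSigns X ≠ X := by
  obtain ⟨⟨i, b⟩, hi⟩ := hne
  intro h
  refine hX.not_mem hi ?_
  rw [← mem_flipSigns, h]
  exact hi

theorem mem_signedSection {S A : Finset ι} {i : ι} {b : Bool} :
    (i, b) ∈ signedSection S A ↔ i ∈ S ∧ b = decide (i ∈ A) := by
  simp only [signedSection, Finset.mem_image, Prod.mk.injEq]
  constructor
  · rintro ⟨_, h, rfl, rfl⟩
    exact ⟨h, rfl⟩
  · rintro ⟨h, rfl⟩
    exact ⟨i, h, rfl, rfl⟩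

theorem signedSection_injective (A : Finset ι) :
    Function.Injective fun i => (i, decide (i ∈ A)) := fun _ _ h => congrArg Prod.fst h

theorem card_signedSection (S A : Finset ι) : (signedSection S A).card = S.card :=
  Finset.card_image_of_injective _ (signedSection_injective A)

theorem isConsistent_signedSection (S A : Finset ι) : IsConsistent (signedSection S A) := by
  intro i h1 h2
  rw [mem_signedSection] at h1 h2
  exact absurd (h1.2.trans h2.2.symm) (by simp)

theorem signedSection_congr {S A B : Finset ι} (h : ∀ i ∈ S, i ∈ A ↔ i ∈ B) :
    signedSection S A = signedSection S B :=
  Finset.image_congr fun i hi => by simp [h i hi]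

theorem sum_erase_signedSection {M : Type*} [AddCommMonoid M] (f : Finset (ι × Bool) → M)
    (S A : Finset ι) :
    ∑ a ∈ signedSection S A, f ((signedSection S A).erase a) =
      ∑ i ∈ S, f (signedSection (S.erase i) A) := by
  conv_lhs => rw [signedSection, Finset.sum_image (signedSection_injective A).injOn]
  refine Finset.sum_congr rfl fun i _ => ?_
  rw [signedSection, Finset.image_erase (signedSection_injective A)]

theorem flagCount_flipSigns {w : Finset (ι × Bool) → ZMod 2}
    (hw : ∀ X, IsConsistent X → X.Nonempty → w (flipSigns X) = 1 + w X)
    {X : Finset (ι × Bool)} (hX : IsConsistent X) :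
    flagCount w (flipSigns X) = flagCount (fun Y => 1 + w Y) X := by
  induction X using Finset.strongInduction with
  | H X ih =>
  rcases X.eq_empty_or_nonempty with rfl | hne
  · simp [flipSigns, flagCount_empty]
  · have hne' : (flipSigns X).Nonempty := hne.image _
    rw [flagCount_of_nonempty _ hne, flagCount_of_nonempty _ hne', hw X hX hne]
    congr 1
    rw [flipSigns, Finset.sum_image fun p _ p' _ h => by
      simp only [Prod.mk.injEq, Bool.not_inj_iff] at h
      exact Prod.ext h.1 h.2]
    refine Finset.sum_congr rfl fun a ha => ?_
    rw [← ih _ (Finset.erase_ssubset ha) (hX.mono (Finset.erase_subset _ _)), flipSigns_erase]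
    rfl

/-- The number of maximal flags of weight one ending in a signed set with full support `S` is
odd if the weight is antipodal. -/
theorem sum_flagCount_signedSection {w : Finset (ι × Bool) → ZMod 2}
    (hw : ∀ X, IsConsistent X → X.Nonempty → w (flipSigns X) = 1 + w X) (S : Finset ι) :
    ∑ A ∈ S.powerset, flagCount w (signedSection S A) = 1 := by
  induction S using Finset.induction_on with
  | empty => simp [signedSection, flagCount_empty]
  | insert j S hj ih =>
    rw [Finset.sum_powerset_insert hj]
    -- The antipodal map carries sections negative at `j` to sections positive at `j`, at the cost
    -- of replacing `w` by `1 + w`.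
    have h1 : ∑ A ∈ S.powerset, flagCount w (signedSection (insert j S) A) =
        ∑ A ∈ S.powerset,
          flagCount (fun Y => 1 + w Y) (signedSection (insert j S) (insert j A)) := by
      refine Finset.sum_bij' (fun A _ => S \ A) (fun A _ => S \ A) ?_ ?_ ?_ ?_ ?_
      · simp
      · simp
      · intro A hA
        simpa using Finset.mem_powerset.mp hA
      · intro A hA
        simpa using Finset.mem_powerset.mp hA
      · intro A hA
        rw [← flagCount_flipSigns hw (isConsistent_signedSection _ _)]
        congr 1
        ext ⟨i, b⟩
        have hAS := Finset.mem_powerset.mp hA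
        have hjA : j ∉ A := fun h => hj (hAS h)
        rw [mem_flipSigns, mem_signedSection, mem_signedSection]
        refine and_congr_right fun hi => ?_
        rw [Finset.mem_insert] at hi
        rcases hi with rfl | hi
        · cases b <;> simp [hjA]
        · have hij : i ≠ j := fun h => hj (h ▸ hi)
          by_cases hiA : i ∈ A <;> cases b <;> simp [hi, hiA, hij]
    -- The top weights `1 + w` and `w` add up to 1, which leaves the sum over the facets.
    have h2 : ∀ A ∈ S.powerset,
        flagCount (fun Y => 1 + w Y) (signedSection (insert j S) (insert j A)) +
          flagCount w (signedSection (insert j S) (insert j A)) =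
        ∑ i ∈ insert j S, flagCount w (signedSection ((insert j S).erase i) (insert j A)) := by
      intro A _
      have hne : (signedSection (insert j S) (insert j A)).Nonempty :=
        (Finset.insert_nonempty j S).image _
      rw [← sum_erase_signedSection, flagCount_of_nonempty _ hne, flagCount_of_nonempty _ hne,
        sum_flagCount_erase_one_add _ hne, ← add_mul, add_assoc, CharTwo.add_self_eq_zero,
        add_zero, one_mul]
    rw [h1, ← Finset.sum_add_distrib, Finset.sum_congr rfl h2, Finset.sum_comm,
      Finset.sum_insert hj, Finset.erase_insert hj]
    have h3 : ∑ A ∈ S.powerset, flagCount w (signedSection S (insert j A)) = 1 := by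
      rw [← ih]
      refine Finset.sum_congr rfl fun A _ => congrArg _ (signedSection_congr fun i hi => ?_)
      have hij : i ≠ j := fun h => hj (h ▸ hi)
      simp [hij]
    rw [h3, Finset.sum_eq_zero, add_zero]
    intro i hi
    -- Once `i` is erased its sign no longer matters, so the facets cancel in pairs; only those
    -- missing `j` survive.
    refine Finset.sum_involution (fun A _ => symmDiff A {i}) ?_ ?_ ?_ ?_
    · intro A _
      rw [signedSection_congr (B := insert j (symmDiff A {i}))]
      · exact CharTwo.add_self_eq_zero _
      · intro k hk
        have hki : k ≠ i := Finset.ne_of_mem_erase hk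
        simp [Finset.mem_symmDiff, hki]
    · intro A _ _ h
      rw [symmDiff_eq_left] at h
      exact Finset.singleton_ne_empty i h
    · intro A hA
      rw [Finset.mem_powerset] at hA ⊢
      intro k hk
      rw [Finset.mem_symmDiff, Finset.mem_singleton] at hk
      rcases hk with hk | hk
      · exact hA hk.1
      · exact hk.1 ▸ hi
    · intro A _
      exact symmDiff_symmDiff_cancel_right _ _

/-- For every antipodal sign on nonempty consistent signed sets there is a maximal flag of
consistent signed sets whose signs alternate. -/
theorem exists_alternating_flag [Fintype ι] {σ : Finset (ι × Bool) → Bool}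
    (hσ : ∀ X, IsConsistent X → X.Nonempty → σ (flipSigns X) = !σ X) :
    ∃ F : ℕ → Finset (ι × Bool), IsConsistent (F (Fintype.card ι)) ∧
      (∀ k ≤ Fintype.card ι, (F k).card = k) ∧ (∀ k < Fintype.card ι, F k ⊆ F (k + 1)) ∧
      ∀ k, 0 < k → k < Fintype.card ι → σ (F (k + 1)) = !σ (F k) := by
  -- Weight one means that the sign agrees with the parity of the size, so signs alternate along a
  -- flag of weight one. Flipping preserves the size, so `w` inherits antipodality.
  let w : Finset (ι × Bool) → ZMod 2 := fun X => if σ X = decide (Even X.card) then 1 else 0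
  have hw : ∀ X, IsConsistent X → X.Nonempty → w (flipSigns X) = 1 + w X := by
    intro X hX hne
    simp only [w, hσ X hX hne, card_flipSigns]
    cases σ X <;> cases decide (Even X.card) <;> decide
  have h := sum_flagCount_signedSection hw Finset.univ
  obtain ⟨A, -, hA⟩ := Finset.exists_ne_zero_of_sum_ne_zero (h.trans_ne one_ne_zero)
  obtain ⟨F, h1, h2, h3, h4⟩ := exists_flag_of_flagCount_ne_zero w hA
  rw [card_signedSection, Finset.card_univ] at h1 h2 h3 h4
  refine ⟨F, h1 ▸ isConsistent_signedSection _ _, h2, h3, fun k hk hk' => ?_⟩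
  have key : ∀ k, 0 < k → k ≤ Fintype.card ι → σ (F k) = decide (Even k) := by
    intro k hk hk'
    have := h4 k hk hk'
    simp only [w, h2 k hk'] at this
    by_contra hne
    rw [if_neg hne] at this
    exact zero_ne_one this
  rw [key k hk hk'.le, key (k + 1) (by omega) hk']
  by_cases hev : Even k <;> simp [hev, Nat.even_add_one]

end SignedSets

/-! ### Top colors along flags and the crown -/

section SignedEdges

variable {ι E : Type*}

/-- The alternating sequence of signs starting with `b`. -/
def altSign (b : Bool) (j : ℕ) : Bool := if Even j then b else !b

theorem altSign_zero (b : Bool) : altSign b 0 = b := by simp [altSign]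

theorem altSign_succ (b : Bool) (j : ℕ) : altSign b (j + 1) = !altSign b j := by
  by_cases h : Even j <;> simp [altSign, Nat.even_add_one, h]

theorem altSign_not (b : Bool) (j : ℕ) : altSign (!b) j = !altSign b j := by
  by_cases h : Even j <;> simp [altSign, h]

/-- All points of the edge `e` carry the sign `b` in `X`. -/
def HasSignedEdge (s : E → Finset ι) (X : Finset (ι × Bool)) (e : E) (b : Bool) : Prop :=
  ∀ i ∈ s e, (i, b) ∈ X

/-- The largest color of an edge with constant sign in `X` is `k`, and it occurs with sign `b`. -/
def HasTopColor (s : E → Finset ι) (c : E → ℕ) (X : Finset (ι × Bool)) (b : Bool) (k : ℕ) :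
    Prop :=
  (∃ e, HasSignedEdge s X e b ∧ c e = k) ∧ ∀ e b', HasSignedEdge s X e b' → c e ≤ k

variable {s : E → Finset ι} {c : E → ℕ}

theorem HasSignedEdge.mono {X Y : Finset (ι × Bool)} (h : X ⊆ Y) {e : E} {b : Bool}
    (he : HasSignedEdge s X e b) : HasSignedEdge s Y e b :=
  fun i hi => h (he i hi)

theorem HasSignedEdge.disjoint {X : Finset (ι × Bool)} (hX : IsConsistent X) {e e' : E} {b : Bool}
    (he : HasSignedEdge s X e b) (he' : HasSignedEdge s X e' (!b)) : Disjoint (s e) (s e') :=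
  Finset.disjoint_left.mpr fun i h h' => hX.not_mem (he i h) (he' i h')

theorem hasSignedEdge_flipSigns [DecidableEq ι] {X : Finset (ι × Bool)} {e : E} {b : Bool} :
    HasSignedEdge s (flipSigns X) e b ↔ HasSignedEdge s X e (!b) := by
  simp only [HasSignedEdge, mem_flipSigns]

theorem HasTopColor.flipSigns [DecidableEq ι] {X : Finset (ι × Bool)} {b : Bool} {k : ℕ}
    (h : HasTopColor s c X b k) : HasTopColor s c (flipSigns X) (!b) k := by
  obtain ⟨⟨e, he, hk⟩, h⟩ := h
  refine ⟨⟨e, ?_, hk⟩, fun e b' h' => h e (!b') ?_⟩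
  · rw [hasSignedEdge_flipSigns, Bool.not_not]
    exact he
  · rwa [hasSignedEdge_flipSigns] at h'

theorem exists_hasTopColor {t : ℕ} (hc : ∀ e, c e < t) {X : Finset (ι × Bool)}
    (h : ∃ e b, HasSignedEdge s X e b) : ∃ b k, HasTopColor s c X b k := by
  classical
  obtain ⟨e, b, he⟩ := h
  let P : ℕ → Prop := fun k => ∃ e b, HasSignedEdge s X e b ∧ c e = k
  obtain ⟨e', b', he', hk⟩ : P (Nat.findGreatest P t) :=
    Nat.findGreatest_spec (P := P) (hc e).le ⟨e, b, he, rfl⟩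
  exact ⟨b', _, ⟨e', he', hk⟩, fun f b'' hf =>
    Nat.le_findGreatest (P := P) (hc f).le ⟨f, b'', hf, rfl⟩⟩

/-- The edge attaining `k` persists in `Y`, where it is disjoint from the edge of opposite sign
attaining `l`. -/
theorem HasTopColor.lt {X Y : Finset (ι × Bool)} (hcol : ∀ e e', Disjoint (s e) (s e') → c e ≠ c e')
    (hXY : X ⊆ Y) (hY : IsConsistent Y) {b : Bool} {k l : ℕ} (hk : HasTopColor s c X b k)
    (hl : HasTopColor s c Y (!b) l) : k < l := by
  obtain ⟨⟨e, he, rfl⟩, -⟩ := hk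
  obtain ⟨⟨e', he', rfl⟩, hmax⟩ := hl
  exact lt_of_le_of_ne (hmax e b (he.mono hXY)) (hcol _ _ ((he.mono hXY).disjoint hY he'))

/-- Along a flag with alternating signs of the top colors these colors increase strictly. -/
theorem hasTopColor_flag (hcol : ∀ e e', Disjoint (s e) (s e') → c e ≠ c e')
    {F : ℕ → Finset (ι × Bool)} {m : ℕ} {b : Bool} (hF : ∀ j < m, F j ⊆ F (j + 1))
    (hcons : ∀ j ≤ m, IsConsistent (F j))
    {k : ℕ → ℕ} (hk : ∀ j ≤ m, HasTopColor s c (F j) (altSign b j) (k j)) :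
    (∀ j ≤ m, j ≤ k j) ∧ ∀ j ≤ m, k j + (m - j) ≤ k m := by
  have hlt : ∀ j < m, k j < k (j + 1) := fun j hj =>
    (hk j hj.le).lt hcol (hF j hj) (hcons _ hj) (altSign_succ b j ▸ hk (j + 1) hj)
  constructor
  · intro j
    induction j with
    | zero => simp
    | succ j ih =>
      intro hj
      have := ih (by omega)
      have := hlt j (by omega)
      omega
  · intro j hj
    induction hj using Nat.decreasingInduction with
    | self => simp
    | of_succ j hj ih =>
      have := hlt j hj
      omega

/-- A flag above `x` with one set for each color, in which the signs of the top colors alternate. -/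
def IsUpperFlag (s : E → Finset ι) (c : E → ℕ) (t : ℕ) (b : Bool) (x : Finset (ι × Bool))
    (F : ℕ → Finset (ι × Bool)) : Prop :=
  F 0 = x ∧ (∀ j ≤ t, (F j).card = x.card + j) ∧ (∀ j < t, F j ⊆ F (j + 1)) ∧
    IsConsistent (F t) ∧ ∀ j < t, ∃ k, HasTopColor s c (F (j + 1)) (altSign b j) k

theorem IsUpperFlag.flipSigns [DecidableEq ι] {t : ℕ} {b : Bool} {x : Finset (ι × Bool)}
    {F : ℕ → Finset (ι × Bool)} (h : IsUpperFlag s c t b x F) :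
    IsUpperFlag s c t (!b) (flipSigns x) fun j => _root_.flipSigns (F j) := by
  obtain ⟨h1, h2, h3, h4, h5⟩ := h
  refine ⟨congrArg _ h1, fun j hj => ?_, fun j hj => flipSigns_mono (h3 j hj), h4.flipSigns,
    fun j hj => ?_⟩
  · rw [card_flipSigns, card_flipSigns, h2 j hj]
  · obtain ⟨k, hk⟩ := h5 j hj
    exact ⟨k, altSign_not b j ▸ hk.flipSigns⟩

theorem IsUpperFlag.subset {t : ℕ} {b : Bool} {x : Finset (ι × Bool)}
    {F : ℕ → Finset (ι × Bool)} (h : IsUpperFlag s c t b x F) {i j : ℕ} (hij : i ≤ j)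
    (hj : j ≤ t) : F i ⊆ F j := by
  induction j, hij using Nat.le_induction with
  | base => exact subset_rfl
  | succ j hij ih => exact (ih (by omega)).trans (h.2.2.1 j (by omega))

/-- The top colors are `t` strictly increasing numbers below `t`, hence exactly `0, …, t - 1`. An
edge of color `j` first appears at step `j`, so the point `u` added there has its sign. -/
theorem IsUpperFlag.exists_points {t : ℕ} (hc : ∀ e, c e < t)
    (hcol : ∀ e e', Disjoint (s e) (s e') → c e ≠ c e') {b : Bool}
    {x : Finset (ι × Bool)} (hx : ∀ e b', ¬ HasSignedEdge s x e b')
    {F : ℕ → Finset (ι × Bool)} (h : IsUpperFlag s c t b x F) (j : ℕ) (hj : j < t) :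
    (∀ e b', HasSignedEdge s (F (j + 1)) e b' → c e ≤ j) ∧
      ∃ u, (u, altSign b j) ∈ F (j + 1) ∧ ∀ b', (u, b') ∉ F j := by
  have hcons : ∀ i ≤ t, IsConsistent (F i) := fun i hi => h.2.2.2.1.mono (h.subset hi le_rfl)
  have hex : ∀ i, ∃ k, i < t → HasTopColor s c (F (i + 1)) (altSign b i) k := fun i => by
    by_cases hi : i < t
    · obtain ⟨k, hk⟩ := h.2.2.2.2 i hi
      exact ⟨k, fun _ => hk⟩
    · exact ⟨0, fun h => absurd h hi⟩
  choose k hk using hex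
  obtain ⟨h1, h2⟩ := hasTopColor_flag (F := fun i => F (i + 1)) (m := t - 1) hcol
    (fun i hi => h.2.2.1 _ (by omega)) (fun i hi => hcons _ (by omega))
    (fun i hi => hk i (by omega))
  have hkj : ∀ i < t, k i = i := by
    intro i hi
    obtain ⟨⟨e, -, he⟩, -⟩ := hk (t - 1) (by omega)
    have := h1 i (by omega)
    have := h2 i (by omega)
    have := hc e
    omega
  have hmax : ∀ i < t, ∀ e b', HasSignedEdge s (F (i + 1)) e b' → c e ≤ i := fun i hi e b' he =>
    hkj i hi ▸ (hk i hi).2 e b' he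
  refine ⟨hmax j hj, ?_⟩
  obtain ⟨⟨e, he, hek⟩, -⟩ := hk j hj
  rw [hkj j hj] at hek
  have hnot : ¬ HasSignedEdge s (F j) e (altSign b j) := by
    intro he'
    cases j with
    | zero => exact hx e _ (h.1 ▸ he')
    | succ i =>
      have := hmax i (by omega) e _ he'
      omega
  simp only [HasSignedEdge, not_forall] at hnot
  obtain ⟨u, hu, hu'⟩ := hnot
  refine ⟨u, he u hu, fun b' hb' => ?_⟩
  rcases Bool.eq_or_eq_not b' (altSign b j) with rfl | rfl
  · exact hu' hb'
  · exact (hcons (j + 1) hj).not_mem (he u hu) (h.2.2.1 j hj hb')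

theorem disjoint_of_hasSignedEdge_insert [DecidableEq ι] {x : Finset (ι × Bool)}
    (hx : IsConsistent x) {w w' : ι} (hw : ∀ b, (w, b) ∉ x) (hw' : ∀ b, (w', b) ∉ x)
    (hne : w ≠ w') {e e' : E} {b : Bool} (he : HasSignedEdge s (insert (w, b) x) e b)
    (he' : HasSignedEdge s (insert (w', !b) x) e' (!b)) : Disjoint (s e) (s e') := by
  refine Finset.disjoint_left.mpr fun i hi hi' => ?_
  have h1 := he i hi
  have h2 := he' i hi'
  simp only [Finset.mem_insert, Prod.mk.injEq, and_true] at h1 h2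
  rcases h1 with rfl | h1
  · rcases h2 with h2 | h2
    · exact hne h2
    · exact hw _ h2
  · rcases h2 with rfl | h2
    · exact hw' _ h1
    · exact hx.not_mem h1 h2

/-- A signed set is edge-free if no edge has constant sign in it; above a maximal one, two upper
flags starting with opposite signs yield a complete bipartite graph minus a perfect matching. -/
theorem exists_crown_of_isUpperFlag [DecidableEq ι] {t d : ℕ} (hc : ∀ e, c e < t)
    (hcol : ∀ e e', Disjoint (s e) (s e') → c e ≠ c e')
    (hbig : ∀ X, IsConsistent X → d < X.card → ∃ e b, HasSignedEdge s X e b)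
    {x : Finset (ι × Bool)} (hx : ∀ e b, ¬ HasSignedEdge s x e b) (hxd : x.card = d)
    {F F' : ℕ → Finset (ι × Bool)} (hF : IsUpperFlag s c t true x F)
    (hF' : IsUpperFlag s c t false x F') :
    ∃ a b : Fin t → E, (∀ j, c (a j) = j) ∧ (∀ j, c (b j) = j) ∧
      ∀ i j, i ≠ j → Disjoint (s (a i)) (s (b j)) := by
  have hxc : IsConsistent x := by
    rw [← hF.1]
    exact hF.2.2.2.1.mono (hF.subset (Nat.zero_le _) le_rfl)
  -- One more point exceeds the size `d`; an edge of the sign opposite to the new point would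
  -- already lie in `x`.
  have hedge : ∀ w, (∀ b, (w, b) ∉ x) → ∀ b, ∃ e, HasSignedEdge s (insert (w, b) x) e b := by
    intro w hw b
    have hcons : IsConsistent (insert (w, b) x) := by
      intro i h1 h2
      simp only [Finset.mem_insert, Prod.mk.injEq] at h1 h2
      rcases h1 with ⟨rfl, rfl⟩ | h1
      · exact h2.elim (fun h => by simpa using h.2) (hw _)
      · rcases h2 with ⟨rfl, rfl⟩ | h2
        · exact hw _ h1
        · exact hxc i h1 h2
    obtain ⟨e, b', he⟩ := hbig _ hcons (by rw [Finset.card_insert_of_notMem (hw b)]; omega)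
    rcases Bool.eq_or_eq_not b' b with rfl | rfl
    · exact ⟨e, he⟩
    · refine absurd (fun i hi => ?_) (hx e (!b))
      have := he i hi
      simpa using this
  choose e he using hedge
  have hu := fun j hj => hF.exists_points hc hcol hx j hj
  have hv := fun j hj => hF'.exists_points hc hcol hx j hj
  choose hmaxu u hu1 hu2 using hu
  choose hmaxv v hv1 hv2 using hv
  have hux : ∀ j hj b, (u j hj, b) ∉ x := fun j hj b h =>
    hu2 j hj b (hF.subset (Nat.zero_le j) hj.le (hF.1 ▸ h))
  have hvx : ∀ j hj b, (v j hj, b) ∉ x := fun j hj b h =>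
    hv2 j hj b (hF'.subset (Nat.zero_le j) hj.le (hF'.1 ▸ h))
  have huu : ∀ i j hi hj, i < j → u j hj ≠ u i hi := fun i j hi hj hij h =>
    hu2 j hj _ (h ▸ hF.subset hij hj.le (hu1 i hi))
  have hvv : ∀ i j hi hj, i < j → v j hj ≠ v i hi := fun i j hi hj hij h =>
    hv2 j hj _ (h ▸ hF'.subset hij hj.le (hv1 i hi))
  -- Both flags add the same points in the same order, and with either sign the `j`th point creates
  -- an edge of color `j`.
  have key : ∀ j (hj : j < t), u j hj = v j hj ∧ ∀ b, c (e (u j hj) (hux j hj) b) = j := by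
    intro j
    induction j using Nat.strong_induction_on with
    | _ j ih =>
    intro hj
    -- A color `i < j` would clash with the edge of opposite sign at `u i`, which has color `i` and
    -- is disjoint from this one.
    have hlow : ∀ w (hw : ∀ b, (w, b) ∉ x) b, (∀ i hi, i < j → w ≠ u i hi) →
        c (e w hw b) ≤ j → c (e w hw b) = j := by
      intro w hw b hne hle
      by_contra hlt
      have hi : c (e w hw b) < j := by omega
      have h1 := (ih _ hi (by omega)).2 (!b)
      refine hcol _ _ ?_ h1.symm
      exact disjoint_of_hasSignedEdge_insert hxc hw (hux _ _) (hne _ _ hi) (he _ _ _) (he _ _ _)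
    have hU := hlow (u j hj) (hux j hj) (altSign true j) (fun i hi hij => huu i j hi hj hij)
      (hmaxu j hj _ _ ((he _ _ _).mono (Finset.insert_subset (hu1 j hj)
        (hF.1 ▸ hF.subset (Nat.zero_le _) hj))))
    have hV := hlow (v j hj) (hvx j hj) (altSign false j)
      (fun i hi hij => by rw [(ih i hij hi).1]; exact hvv i j hi hj hij)
      (hmaxv j hj _ _ ((he _ _ _).mono (Finset.insert_subset (hv1 j hj)
        (hF'.1 ▸ hF'.subset (Nat.zero_le _) hj))))
    have huv : u j hj = v j hj := by
      by_contra hne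
      refine hcol _ _ ?_ (hU.trans hV.symm)
      refine disjoint_of_hasSignedEdge_insert hxc (hux j hj) (hvx j hj) hne (he _ _ _) ?_
      rw [← altSign_not]
      exact he _ _ _
    refine ⟨huv, fun b => ?_⟩
    simp only [← huv] at hV
    rcases Bool.eq_or_eq_not b (altSign true j) with rfl | rfl
    · exact hU
    · rw [← altSign_not]
      exact hV
  refine ⟨fun j => e (u j j.2) (hux j j.2) true, fun j => e (u j j.2) (hux j j.2) false,
    fun j => (key j j.2).2 _, fun j => (key j j.2).2 _, fun i j hij => ?_⟩
  refine disjoint_of_hasSignedEdge_insert (b := true) hxc (hux i i.2) (hux j j.2) ?_ (he _ _ _)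
    (he _ _ _)
  have hij' : (i : ℕ) ≠ j := fun h => hij (Fin.ext h)
  rcases lt_or_gt_of_ne hij' with h | h
  · exact (huu _ _ _ _ h).symm
  · exact huu _ _ _ _ h

/-- A predicate that never holds at a signed set and its flip extends to an antipodal sign. -/
theorem exists_antipodal_sign [Countable ι] [DecidableEq ι] (P : Finset (ι × Bool) → Prop)
    (hP : ∀ X, IsConsistent X → P X → ¬ P (flipSigns X)) :
    ∃ σ : Finset (ι × Bool) → Bool,
      (∀ X, IsConsistent X → X.Nonempty → σ (flipSigns X) = !σ X) ∧
        ∀ X, P X → σ X = true := by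
  classical
  obtain ⟨f, hf⟩ := Countable.exists_injective_nat (Finset (ι × Bool))
  -- Where `P` decides neither `X` nor its flip, an arbitrary enumeration breaks the tie.
  refine ⟨fun X => if P X then true else if P (flipSigns X) then false else
    decide (f X < f (flipSigns X)), fun X hX hne => ?_, fun X h => if_pos h⟩
  have hlt : f (flipSigns X) ≠ f X := fun h => hX.flipSigns_ne hne (hf h)
  simp only [flipSigns_flipSigns]
  by_cases h1 : P X
  · simp [h1, hP X hX h1]
  · by_cases h2 : P (flipSigns X)
    · simp [h1, h2]
    · simp only [h1, h2, if_false]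
      rcases lt_or_gt_of_ne hlt with h | h <;> simp [h, h.le]

/-- If every consistent signed set with more than `d` points contains an edge of constant sign,
then every proper coloring of the disjointness graph of the edges with `card ι - d` colors contains
a complete bipartite graph minus a perfect matching, each side of which has all the colors. -/
theorem exists_crown [Fintype ι] [DecidableEq ι] {t d : ℕ} (hd : 0 < d)
    (hdt : d + t = Fintype.card ι) (hc : ∀ e, c e < t)
    (hcol : ∀ e e', Disjoint (s e) (s e') → c e ≠ c e')
    (hbig : ∀ X, IsConsistent X → d < X.card → ∃ e b, HasSignedEdge s X e b) :
    ∃ a b : Fin t → E, (∀ j, c (a j) = j) ∧ (∀ j, c (b j) = j) ∧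
      ∀ i j, i ≠ j → Disjoint (s (a i)) (s (b j)) := by
  rcases Nat.eq_zero_or_pos t with rfl | ht
  · exact ⟨fun j => j.elim0, fun j => j.elim0, fun j => j.elim0, fun j => j.elim0,
      fun j => j.elim0⟩
  by_contra hcrown
  -- The sign is that of the top color; an edge-free set of size `d` takes the starting sign of an
  -- upper flag above it, which is unambiguous if there is no crown.
  let Q : Bool → Finset (ι × Bool) → Prop := fun b X =>
    (∃ k, HasTopColor s c X b k) ∨
      X.card = d ∧ (∀ e b', ¬ HasSignedEdge s X e b') ∧ ∃ F, IsUpperFlag s c t b X F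
  have hQflip : ∀ b X, Q b X → Q (!b) (flipSigns X) := by
    rintro b X (⟨k, hk⟩ | ⟨h1, h2, F, hF⟩)
    · exact Or.inl ⟨k, hk.flipSigns⟩
    · refine Or.inr ⟨by rw [card_flipSigns, h1], fun e b' h => h2 e (!b') ?_, _, hF.flipSigns⟩
      rwa [hasSignedEdge_flipSigns] at h
  have hQ : ∀ X, IsConsistent X → Q true X → ¬ Q false X := by
    rintro X hX (⟨k, hk⟩ | ⟨h1, h2, F, hF⟩) (⟨l, hl⟩ | ⟨h1', h2', F', hF'⟩)
    · exact lt_asymm (hk.lt hcol subset_rfl hX hl) (hl.lt hcol subset_rfl hX hk)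
    · obtain ⟨⟨e, he, -⟩, -⟩ := hk
      exact h2' _ _ he
    · obtain ⟨⟨e, he, -⟩, -⟩ := hl
      exact h2 _ _ he
    · exact hcrown (exists_crown_of_isUpperFlag hc hcol hbig h2 h1 hF hF')
  obtain ⟨σ, hσ, hσQ⟩ := exists_antipodal_sign (Q true) fun X hX h h' =>
    hQ X hX h (by simpa [flipSigns_flipSigns] using hQflip _ _ h')
  have hσQ' : ∀ b X, IsConsistent X → X.Nonempty → Q b X → σ X = b := by
    intro b X hX hne h
    cases b
    · have := hσQ _ (hQflip _ _ h)
      rw [hσ X hX hne] at this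
      simpa using this
    · exact hσQ X h
  obtain ⟨F, hcons, hcard, hsub, halt⟩ := exists_alternating_flag hσ
  have hcons' : ∀ k ≤ Fintype.card ι, IsConsistent (F k) := by
    intro k hk
    induction hk using Nat.decreasingInduction with
    | self => exact hcons
    | of_succ k hk ih => exact ih.mono (hsub k hk)
  have hne : ∀ k, 0 < k → k ≤ Fintype.card ι → (F k).Nonempty := fun k hk hk' =>
    Finset.card_pos.mp (by rw [hcard k hk']; exact hk)
  have htop : ∀ k, 0 < k → k ≤ Fintype.card ι → (∃ e b, HasSignedEdge s (F k) e b) →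
      ∃ l, HasTopColor s c (F k) (σ (F k)) l := by
    intro k hk hk' h
    obtain ⟨b, l, h⟩ := exists_hasTopColor hc h
    exact ⟨l, (hσQ' b _ (hcons' k hk') (hne k hk hk') (Or.inl ⟨l, h⟩)).symm ▸ h⟩
  have hsign : ∀ m, 0 < m → ∀ j, m + j ≤ Fintype.card ι →
      σ (F (m + j)) = altSign (σ (F m)) j := by
    intro m hm j
    induction j with
    | zero => exact fun _ => (altSign_zero _).symm
    | succ j ih =>
      intro hj
      rw [altSign_succ, ← ih (by omega), ← add_assoc]
      exact halt _ (by omega) (by omega)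
  -- Otherwise the `t + 1` sets from `F d` upwards would have strictly increasing top colors below
  -- `t`.
  have hfree : ∀ e b, ¬ HasSignedEdge s (F d) e b := by
    intro e b he
    have hex : ∀ j, ∃ l, j ≤ t → HasTopColor s c (F (d + j)) (altSign (σ (F d)) j) l := by
      intro j
      by_cases hj : j ≤ t
      · have hedge : ∃ e b, HasSignedEdge s (F (d + j)) e b := by
          rcases Nat.eq_zero_or_pos j with rfl | hj0
          · exact ⟨e, b, he⟩
          · exact hbig _ (hcons' _ (by omega)) (by rw [hcard _ (by omega)]; omega)
        obtain ⟨l, hl⟩ := htop (d + j) (by omega) (by omega) hedge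
        exact ⟨l, fun _ => hsign d hd j (by omega) ▸ hl⟩
      · exact ⟨0, fun h => absurd h hj⟩
    choose l hl using hex
    have := (hasTopColor_flag (F := fun j => F (d + j)) hcol (fun j hj => hsub _ (by omega))
      (fun j hj => hcons' _ (by omega)) hl).1 t le_rfl
    obtain ⟨⟨e', -, he'⟩, -⟩ := hl t le_rfl
    have := hc e'
    omega
  have hup : IsUpperFlag s c t (σ (F (d + 1))) (F d) fun j => F (d + j) := by
    refine ⟨rfl, fun j hj => ?_, fun j hj => hsub _ (by omega), hcons' _ (by omega),
      fun j hj => ?_⟩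
    · rw [hcard _ (by omega), hcard _ (by omega)]
    · rw [← hsign (d + 1) (by omega) j (by omega), show d + 1 + j = d + (j + 1) by omega]
      exact htop _ (by omega) (by omega)
        (hbig _ (hcons' _ (by omega)) (by rw [hcard _ (by omega)]; omega))
  -- The definition of the sign gives `F d` the sign of `F (d + 1)`, against alternation.
  have h1 := hσQ' _ _ (hcons' d (by omega)) (hne d hd (by omega))
    (Or.inr ⟨hcard d (by omega), hfree, _, hup⟩)
  have h2 := halt d hd (by omega)
  rw [h1] at h2
  simp at h2

end SignedEdges

/-! ### Circular colorings of a crown -/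

/-- A circular coloring whose quotients by `q` color a complete bipartite graph minus a perfect
matching with `t` colors on each side uses at least `t * q` colors. -/
theorem SimpleGraph.IsCircularColoring.mul_le_of_crown {V : Type*} {G : SimpleGraph V}
    {p q t : ℕ} {f : V → Fin p} (hf : G.IsCircularColoring p q f) (ht : 2 ≤ t) {a b : Fin t → V}
    (ha : ∀ j, (f (a j) : ℕ) / q = j) (hb : ∀ j, (f (b j) : ℕ) / q = j)
    (hab : ∀ i j, i ≠ j → G.Adj (a i) (b j)) : t * q ≤ p := by
  have hstep : ∀ u v : V, G.Adj u v → (f u : ℕ) / q < (f v : ℕ) / q →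
      (f u : ℕ) + q ≤ f v ∧ (f v : ℕ) + q ≤ f u + p := by
    intro u v huv hlt
    have hle : (f u : ℕ) ≤ f v := by
      by_contra h
      exact absurd (Nat.div_le_div_right (c := q) (le_of_not_ge h)) (by omega)
    obtain ⟨h1, h2⟩ := hf u v huv
    rw [abs_sub_comm, abs_of_nonneg (by omega)] at h1 h2
    omega
  -- The crossing edges from `a j` to `b (j + 1)` and from `b j` to `a (j + 1)` each gain at least
  -- `q`.
  have hsum : ∀ j (hj : j < t), (f (a ⟨0, by omega⟩) : ℕ) + f (b ⟨0, by omega⟩) + 2 * (j * q) ≤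
      f (a ⟨j, hj⟩) + f (b ⟨j, hj⟩) := by
    intro j
    induction j with
    | zero => simp
    | succ j ih =>
      intro hj
      have h0 := ih (by omega)
      have hne : (⟨j, by omega⟩ : Fin t) ≠ ⟨j + 1, hj⟩ := by simp
      have h1 := (hstep _ _ (hab _ _ hne) (by rw [ha, hb]; exact Nat.lt_succ_self j)).1
      have h2 := (hstep _ _ (hab _ _ hne.symm).symm (by rw [ha, hb]; exact Nat.lt_succ_self j)).1
      rw [add_mul, one_mul]
      omega
  have h0 := hsum (t - 1) (by omega)
  have hne : (⟨0, by omega⟩ : Fin t) ≠ ⟨t - 1, by omega⟩ := by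
    simp only [ne_eq, Fin.mk.injEq]
    omega
  have hpos : 0 < t - 1 := by omega
  -- The two edges between levels `0` and `t - 1` span at most `p - q` each, which closes the cycle.
  have h1 := (hstep _ _ (hab _ _ hne) (by rw [ha, hb]; exact hpos)).2
  have h2 := (hstep _ _ (hab _ _ hne.symm).symm (by rw [ha, hb]; exact hpos)).2
  obtain ⟨r, rfl⟩ : ∃ r, t = r + 1 := ⟨t - 1, by omega⟩
  simp only [Nat.add_sub_cancel] at h0 h1 h2
  rw [add_mul, one_mul]
  omega

theorem SimpleGraph.circularChromaticNumber_le_of_colorable {V : Type*} {G : SimpleGraph V} {t : ℕ}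
    (ht : 1 ≤ t) (h : G.Colorable t) : G.circularChromaticNumber ≤ t := by
  obtain ⟨C⟩ := h
  refine sInf_le ⟨t, 1, le_rfl, ht, ⟨C, fun u v huv => ?_⟩, by simp⟩
  have hne : (C u : ℕ) ≠ C v := fun h => C.valid huv (Fin.ext h)
  have h1 := (C u).2
  have h2 := (C v).2
  rw [le_abs, abs_le]
  omega

/-! ### From the 2-colorability defect to signed sets -/

namespace Hypergraph

variable {α : Type*} (H : Hypergraph α)

theorem colorabilityDefect_eq_top (h : ∅ ∈ H.edgeSet) : H.colorabilityDefect = ⊤ := by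
  simp only [colorabilityDefect, iInf_eq_top]
  rintro U ⟨-, c, hc⟩
  exact absurd ⟨true, fun x hx => absurd hx (Set.notMem_empty x)⟩
    (hc ∅ ⟨h, Set.empty_inter U⟩)

theorem colorabilityDefect_le_encard (h : ∅ ∉ H.edgeSet) :
    H.colorabilityDefect ≤ H.vertexSet.encard := by
  refine iInf₂_le _ ⟨subset_rfl, fun _ => true, fun e he => absurd he.1 ?_⟩
  have hsub : e ⊆ H.vertexSet := H.subset_vertexSet_of_mem_edgeSet' he.1
  have he2 : e ∩ H.vertexSet = ∅ := he.2
  rw [Set.inter_eq_left.mpr hsub] at he2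
  exact he2 ▸ h

open Classical in
/-- The points of an edge, as elements of the vertex set with one additional point. -/
noncomputable def edgePoints [Fintype H.vertexSet] (e : H.edgeSet) : Finset (Option H.vertexSet) :=
  Finset.univ.filter fun o => ∃ v, o = some v ∧ (v : α) ∈ (e : Set α)

theorem some_mem_edgePoints [Fintype H.vertexSet] {e : H.edgeSet} {v : H.vertexSet} :
    some v ∈ H.edgePoints e ↔ (v : α) ∈ (e : Set α) := by
  simp [edgePoints]

theorem kneserGraph_adj_of_disjoint [Fintype H.vertexSet] (h : ∅ ∉ H.edgeSet) {e f : H.edgeSet}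
    (hd : Disjoint (H.edgePoints e) (H.edgePoints f)) : H.kneserGraph.Adj e f := by
  have hdis : Disjoint (e : Set α) (f : Set α) := by
    refine Set.disjoint_left.mpr fun x hx hx' => ?_
    have hv : x ∈ H.vertexSet := H.subset_vertexSet_of_mem_edgeSet' e.2 hx
    exact Finset.disjoint_left.mp hd (H.some_mem_edgePoints (v := ⟨x, hv⟩) |>.mpr hx)
      (H.some_mem_edgePoints.mpr hx')
  refine ⟨fun hef => h ?_, hdis⟩
  subst hef
  rw [← Set.bot_eq_empty, ← disjoint_self.mp hdis]
  exact e.2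

/-- A signed set of vertices (and the additional point) that is too large for its complement to
be removed in the definition of the 2-colorability defect contains an edge of constant sign. -/
theorem exists_hasSignedEdge [Fintype H.vertexSet] {t : ℕ} (ht : t ≤ H.colorabilityDefect)
    (X : Finset (Option H.vertexSet × Bool)) (hX : IsConsistent X)
    (hcard : Fintype.card H.vertexSet + 1 < X.card + t) :
    ∃ e b, HasSignedEdge H.edgePoints X e b := by
  classical
  let W : Finset H.vertexSet := Finset.univ.filter fun v => ∀ b, (some v, b) ∉ X
  let U : Set α := Subtype.val '' (W : Set H.vertexSet)
  have hUcard : U.encard = W.card := by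
    rw [Subtype.val_injective.encard_image, Set.encard_coe_eq_coe_finsetCard]
  have hWX : W.card + X.card ≤ Fintype.card H.vertexSet + 1 := by
    have himg : (X.image Prod.fst).card = X.card := by
      refine Finset.card_image_of_injOn ?_
      rintro ⟨i, b⟩ hi ⟨j, b'⟩ hj h
      obtain rfl : i = j := h
      rcases Bool.eq_or_eq_not b' b with rfl | rfl
      · rfl
      · exact absurd hj (hX.not_mem hi)
    have hdis : Disjoint (W.image some) (X.image Prod.fst) := by
      refine Finset.disjoint_left.mpr fun o ho ho' => ?_
      obtain ⟨v, hv, rfl⟩ := Finset.mem_image.mp ho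
      obtain ⟨⟨w, b⟩, hw, rfl⟩ := Finset.mem_image.mp ho'
      exact (Finset.mem_filter.mp hv).2 b hw
    rw [← himg, ← Finset.card_image_of_injective W (Option.some_injective _),
      ← Finset.card_union_of_disjoint hdis, ← Fintype.card_option]
    exact Finset.card_le_univ _
  have hnot : ¬ (H.removeVertices U).IsTwoColorable := by
    intro hU
    have hle : (t : ℕ∞) ≤ U.encard := by
      refine ht.trans (iInf₂_le U ⟨?_, hU⟩)
      rintro _ ⟨v, -, rfl⟩
      exact v.2
    rw [hUcard, Nat.cast_le] at hle
    omega
  simp only [IsTwoColorable, not_exists, not_forall, not_not] at hnot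
  obtain ⟨e, he, b, hb⟩ :=
    -- Vertices unsigned in `X` get `false` by default; they lie in `U`, which the remaining edges
    -- avoid.
    hnot fun x => decide (∃ h : x ∈ H.vertexSet, (some ⟨x, h⟩, true) ∈ X)
  refine ⟨⟨e, he.1⟩, b, fun o ho => ?_⟩
  obtain ⟨v, rfl, hv⟩ := (Finset.mem_filter.mp ho).2
  have hvW : v ∉ W := fun hW =>
    Set.notMem_empty (v : α) (he.2 ▸ ⟨hv, Set.mem_image_of_mem _ hW⟩)
  simp only [W, Finset.mem_filter, Finset.mem_univ, true_and, not_forall, not_not] at hvW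
  obtain ⟨b', hb'⟩ := hvW
  have hbv := hb v hv
  rcases Bool.eq_or_eq_not b' b with rfl | rfl
  · exact hb'
  · cases b
    · exact absurd (show ∃ h : (v : α) ∈ H.vertexSet, (some ⟨v, h⟩, true) ∈ X from ⟨v.2, hb'⟩)
        (of_decide_eq_false hbv)
    · exact (of_decide_eq_true hbv).2

/-- Circular colorings of the Kneser graph obey the 2-colorability defect bound. -/
theorem mul_le_of_isCircularColoring [Fintype H.vertexSet] (h : ∅ ∉ H.edgeSet) {t : ℕ}
    (ht2 : 2 ≤ t) (ht : t ≤ H.colorabilityDefect) {p q : ℕ} (hq : 1 ≤ q)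
    {f : H.edgeSet → Fin p} (hf : H.kneserGraph.IsCircularColoring p q f) : t * q ≤ p := by
  classical
  by_contra hlt
  have htV : t ≤ Fintype.card H.vertexSet := by
    have := ht.trans (H.colorabilityDefect_le_encard h)
    rwa [← Set.coe_fintypeCard, Nat.cast_le] at this
  have hcol : ∀ e e', Disjoint (H.edgePoints e) (H.edgePoints e') →
      (f e : ℕ) / q ≠ (f e' : ℕ) / q := by
    intro e e' hd heq
    have h1 := (hf e e' (H.kneserGraph_adj_of_disjoint h hd)).1
    have h2 := Nat.div_add_mod (f e : ℕ) q
    have h3 := Nat.div_add_mod (f e' : ℕ) q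
    have h4 := Nat.mod_lt (f e : ℕ) hq
    have h5 := Nat.mod_lt (f e' : ℕ) hq
    rw [heq] at h2
    rw [le_abs] at h1
    omega
  -- The additional point, which lies in no edge, keeps `d` positive even if `t` is the number of
  -- vertices; the empty signed set is its own flip and could not carry an antipodal sign.
  obtain ⟨a, b, ha, hb, hab⟩ := exists_crown (s := H.edgePoints) (c := fun e => (f e : ℕ) / q)
    (t := t) (d := Fintype.card H.vertexSet + 1 - t) (by omega)
    (by rw [Fintype.card_option]; omega)
    (fun e => (Nat.div_lt_iff_lt_mul hq).mpr (by have := (f e).2; omega)) hcol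
    (fun X hX hcard => H.exists_hasSignedEdge ht X hX (by omega))
  exact hlt (hf.mul_le_of_crown ht2 ha hb fun i j hij =>
    H.kneserGraph_adj_of_disjoint h (hab i j hij))

end Hypergraph

theorem corollary4p4 {α : Type*} (H : Hypergraph α)
    (hVfin : H.vertexSet.Finite) (hVne : H.vertexSet.Nonempty) (hEne : H.edgeSet.Nonempty)
    (hcd : H.kneserGraph.chromaticNumber = H.colorabilityDefect) :
    (H.kneserGraph.chromaticNumber : ℝ≥0∞) = H.kneserGraph.circularChromaticNumber := by
  classical
  have : Fintype H.vertexSet := hVfin.fintype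
  have hEfin : H.edgeSet.Finite :=
    hVfin.finite_subsets.subset fun e he => H.subset_vertexSet_of_mem_edgeSet' he
  have : Fintype H.edgeSet := hEfin.fintype
  have : Nonempty H.edgeSet := hEne.to_subtype
  have hcolorable := H.kneserGraph.colorable_of_fintype
  have hne : H.kneserGraph.chromaticNumber ≠ ⊤ :=
    SimpleGraph.chromaticNumber_ne_top_iff_exists.mpr ⟨_, hcolorable⟩
  have hempty : ∅ ∉ H.edgeSet := fun h => hne (hcd.trans (H.colorabilityDefect_eq_top h))
  obtain ⟨t, ht⟩ := ENat.ne_top_iff_exists.mp hne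
  have hpos : 1 ≤ t := by
    have := hcolorable.chromaticNumber_pos
    rw [← ht] at this
    exact_mod_cast this
  rw [← ht, ENat.toENNReal_coe]
  refine le_antisymm (le_sInf ?_) (SimpleGraph.circularChromaticNumber_le_of_colorable hpos
    (SimpleGraph.chromaticNumber_le_iff_colorable.mp ht.ge))
  rintro _ ⟨p, q, hq, hqp, ⟨f, hf⟩, rfl⟩
  rw [ENNReal.le_div_iff_mul_le (Or.inl (by exact_mod_cast (show q ≠ 0 by omega)))
    (Or.inl (ENNReal.natCast_ne_top q))]
  suffices t * q ≤ p by exact_mod_cast this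
  -- The crown argument needs two distinct levels; for `t = 1` the claim is just `q ≤ p`.
  rcases hpos.eq_or_lt with rfl | ht2
  · rwa [one_mul]
  · exact H.mul_le_of_isCircularColoring hempty ht2 (ht.trans hcd).le hq hf
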